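/- Let $K\ge 1$ and let $N_0,N_1,\dots,N_K$ be positive integers with $N_0=\min_{0\le k\le K}N_k$. Let $Q_1,\dots,Q_K$ be random complex matrices, $Q_k$ of size $N_k\times N_{k-1}$, such that all entries of all the $Q_k$ are mutually independent, circularly symmetric complex Gaussian variables with mean zero and unit variance (density $\pi^{-1}e^{-|z|^2}$ on $\mathbb{C}$). Let $H=Q_KQ_{K-1}\cdots Q_1$, of size $N_K\times N_0$ (the Rayleigh product channel), and let $q\ge 0$. Then $\ln\det(I+qH^\dagger H)$ is integrable, and the ergodic capacity $\tilde R=\mathbb{E}\left[\ln\det(I+qH^\dagger H)\right]$ satisfies $$N_0\ln\left(1+q\exp(g-K\gamma)\right)\;\le\;\tilde R\;\le\;N_0\ln\left(1+q\prod_{k=1}^{K}N_k\right),$$ where $\gamma$ is the Euler–Mascheroni constant and $$g=\frac{1}{N_0}\sum_{k=1}^{K}\sum_{\ell=1}^{N_0}\sum_{r=1}^{N_k-\ell}\frac1r=K\gamma+\frac{1}{N_0}\sum_{k=1}^{K}\sum_{\ell=1}^{N_0}\psi(N_k-\ell+1),$$ with $\psi=\Gamma'/\Gamma$ the digamma function.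 -/

import Mathlib

open MeasureTheory ProbabilityTheory

noncomputable section

namespace RayleighProduct

/-- The law of a (circularly symmetric) complex Gaussian variable with mean zero and unit variance:
its density with respect to Lebesgue measure on `ℂ` is `exp (-|z|²) / π`. -/
def stdComplexGaussian : Measure ℂ :=
  volume.withDensity fun z => ENNReal.ofReal (Real.exp (-‖z‖ ^ 2) / Real.pi)

/-- The matrices `Q 0, …, Q (K-1)` (of sizes `N (k+1) × N k`) are independent Rayleigh channels:
all entries of all the matrices are mutually independent standard complex Gaussian variables. -/
structure IsRayleigh {Ω : Type*} [MeasurableSpace Ω] (P : Measure Ω) {K : ℕ} (N : Fin (K + 1) → ℕ)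
    (Q : (k : Fin K) → Ω → Matrix (Fin (N k.succ)) (Fin (N k.castSucc)) ℂ) : Prop where
  hasLaw : ∀ k i j, HasLaw (fun ω => Q k ω i j) stdComplexGaussian P
  indep : iIndepFun
    (fun (e : (k : Fin K) × (Fin (N k.succ) × Fin (N k.castSucc))) ω => Q e.1 ω e.2.1 e.2.2) P

/-- The partial products `Q (k-1) * ⋯ * Q 1 * Q 0`, of size `N k × N 0`. -/
def partialProduct {K : ℕ} (N : Fin (K + 1) → ℕ)
    (Q : (k : Fin K) → Matrix (Fin (N k.succ)) (Fin (N k.castSucc)) ℂ) (k : Fin (K + 1)) :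
    Matrix (Fin (N k)) (Fin (N 0)) ℂ :=
  Fin.induction (motive := fun k => Matrix (Fin (N k)) (Fin (N 0)) ℂ) 1 (fun k M => Q k * M) k

/-- The product channel `H = Q (K-1) * ⋯ * Q 1 * Q 0`, of size `N K × N 0`. -/
def productChannel {K : ℕ} (N : Fin (K + 1) → ℕ)
    (Q : (k : Fin K) → Matrix (Fin (N k.succ)) (Fin (N k.castSucc)) ℂ) :
    Matrix (Fin (N (Fin.last K))) (Fin (N 0)) ℂ :=
  partialProduct N Q (Fin.last K)

/-- The capacity `ln det (I + q H† H)` in nats per channel use. The determinant is a positive real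
number for `q ≥ 0`, so it equals its real part. -/
def capacity {m n : ℕ} (q : ℝ) (H : Matrix (Fin m) (Fin n) ℂ) : ℝ :=
  Real.log (1 + (q : ℂ) • (H.conjTranspose * H)).det.re

/-- The ergodic capacity: the expectation of the capacity of the product channel. -/
def ergodicCapacity {Ω : Type*} [MeasurableSpace Ω] (P : Measure Ω) {K : ℕ} (N : Fin (K + 1) → ℕ)
    (Q : (k : Fin K) → Ω → Matrix (Fin (N k.succ)) (Fin (N k.castSucc)) ℂ) (q : ℝ) : ℝ :=
  ∫ ω, capacity q (productChannel N fun k => Q k ω) ∂P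

/-- `g = (1 / N₀) ∑_{k=1}^K ∑_{ℓ=1}^{N₀} ∑_{r=1}^{N_k - ℓ} 1 / r`; used only when `N₀ ≤ N_k`, so that
the natural-number subtraction does not truncate. -/
def gConst {K : ℕ} (N : Fin (K + 1) → ℕ) : ℝ :=
  (1 / (N 0 : ℝ)) * ∑ k : Fin K, ∑ l ∈ Finset.Icc 1 (N 0),
    ∑ r ∈ Finset.Icc 1 (N k.succ - l), 1 / (r : ℝ)

/-- The digamma function `ψ = Γ' / Γ` on the reals. -/
def digamma (x : ℝ) : ℝ := logDeriv Real.Gamma x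

end RayleighProduct

end

/-!
The two bounds are Jensen's inequality for the eigenvalues `λᵢ` of `H† H`: one compares
`ln (1 + q λ)` with its tangent in `λ`, the other with its tangent in `ln λ`. This leaves the means
of `∑ λᵢ = tr (H† H)` and of `ln ∏ λᵢ = ln det (H† H)`.

If `Q` has `p` rows, then `E ‖Q A‖² = p ‖A‖²` for the Frobenius norm of any fixed `A`. If moreover
`A† A` is invertible, then `A = U B` with `U† U = 1` and `B` square, so that
`det ((Q A)† (Q A)) = det ((Q U)† (Q U)) · det (A† A)`, and `Q U` is again Gaussian. Hence both
quantities can be followed one factor at a time. For a Gaussian matrix with `p` rows and `n`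
columns, adding the columns one at a time multiplies the Gram determinant by the squared norm of
the projection of a Gaussian vector to a subspace of dimension `p, p - 1, …, p - n + 1`; for
dimension `d` this is a `Γ(d, 1)` variable, whose logarithm has mean `ψ(d)`.
-/

noncomputable section

namespace RayleighProduct

open Module

section Gaussian

variable {E : Type*} [NormedAddCommGroup E] [InnerProductSpace ℝ E] [FiniteDimensional ℝ E]
  [MeasurableSpace E] [BorelSpace E]

variable (E) in
/-- The centred Gaussian law on a real inner product space whose density is proportional to
`exp (-‖x‖²)`. On a complex space it is the standard circularly symmetric Gaussian law. -/
def gaussian : Measure E :=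
  volume.withDensity fun x =>
    ENNReal.ofReal (Real.exp (-‖x‖ ^ 2) / Real.pi ^ (finrank ℝ E / 2 : ℝ))

lemma gaussian_complex : gaussian ℂ = stdComplexGaussian := by
  simp [gaussian, stdComplexGaussian]

lemma integral_gaussianDensity :
    ∫ x : E, Real.exp (-‖x‖ ^ 2) / Real.pi ^ (finrank ℝ E / 2 : ℝ) = 1 := by
  have h := GaussianFourier.integral_rexp_neg_mul_sq_norm (V := E) one_pos
  simp only [neg_mul, one_mul, div_one] at h
  rw [integral_div, h, div_self (by positivity)]

instance : IsProbabilityMeasure (gaussian E) := by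
  refine ⟨?_⟩
  rw [gaussian, withDensity_apply _ .univ, Measure.restrict_univ,
    ← ofReal_integral_eq_lintegral_ofReal (integrable_of_integral_eq_one integral_gaussianDensity)
      (.of_forall fun x => by positivity), integral_gaussianDensity, ENNReal.ofReal_one]

lemma integral_gaussian {F : Type*} [NormedAddCommGroup F] [NormedSpace ℝ F] (f : E → F) :
    ∫ x, f x ∂gaussian E =
      ∫ x, (Real.exp (-‖x‖ ^ 2) / Real.pi ^ (finrank ℝ E / 2 : ℝ)) • f x := by
  rw [gaussian, integral_withDensity_eq_integral_toReal_smul (by fun_prop) (by simp)]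
  refine integral_congr_ae (.of_forall fun x => ?_)
  beta_reduce
  rw [ENNReal.toReal_ofReal (by positivity)]

lemma charFun_gaussian (t : E) : charFun (gaussian E) t = Complex.exp (-‖t‖ ^ 2 / 4) := by
  have h := GaussianFourier.integral_cexp_neg_mul_sq_norm_add (V := E) (b := 1) (by simp)
    Complex.I t
  have hpi : (Real.pi : ℂ) ^ (finrank ℝ E / 2 : ℂ) ≠ 0 := by simp [Real.pi_ne_zero]
  have hdensity (x : E) : (Real.exp (-‖x‖ ^ 2) / Real.pi ^ (finrank ℝ E / 2 : ℝ)) •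
      Complex.exp ((inner ℝ x t : ℝ) * Complex.I) = ((Real.pi : ℂ) ^ (finrank ℝ E / 2 : ℂ))⁻¹ *
        Complex.exp (-1 * ‖x‖ ^ 2 + Complex.I * (inner ℝ t x : ℝ)) := by
    rw [Complex.exp_add, Complex.real_smul, real_inner_comm]
    push_cast [Complex.ofReal_cpow Real.pi_nonneg]
    rw [mul_comm Complex.I, neg_one_mul]
    field_simp
  simp_rw [charFun_apply, integral_gaussian, hdensity]
  rw [integral_const_mul, h, div_one, inv_mul_cancel_left₀ hpi, Complex.I_sq]
  congr 1
  ring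

lemma map_gaussian_eq_map_smul {F : Type*} [NormedAddCommGroup F] [InnerProductSpace ℝ F]
    [FiniteDimensional ℝ F] [MeasurableSpace F] [BorelSpace F] {Φ : E → F} {Ψ : F → E} {s : ℝ}
    (hΦ : Measurable Φ) (hadj : ∀ x t, inner ℝ (Φ x) t = inner ℝ x (Ψ t))
    (hnorm : ∀ t, ‖Ψ t‖ = ‖s • t‖) :
    (gaussian E).map Φ = (gaussian F).map (s • ·) := by
  have := Measure.isProbabilityMeasure_map (μ := gaussian E) hΦ.aemeasurable
  have := Measure.isProbabilityMeasure_map (μ := gaussian F)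
    (measurable_const_smul s).aemeasurable
  refine Measure.ext_of_charFun (funext fun t => ?_)
  calc charFun ((gaussian E).map Φ) t = charFun (gaussian E) (Ψ t) := by
        rw [charFun_apply, charFun_apply, integral_map (by fun_prop) (by fun_prop)]
        simp_rw [hadj]
    _ = charFun ((gaussian F).map (s • ·)) t := by
        rw [charFun_map_smul, charFun_gaussian, charFun_gaussian, hnorm]

lemma map_toLp_pi_gaussian {ι : Type*} [Fintype ι] (E : ι → Type*)
    [∀ i, NormedAddCommGroup (E i)] [∀ i, InnerProductSpace ℝ (E i)]
    [∀ i, FiniteDimensional ℝ (E i)] [∀ i, MeasurableSpace (E i)] [∀ i, BorelSpace (E i)] :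
    (Measure.pi fun i => gaussian (E i)).map (WithLp.toLp 2) = gaussian (PiLp 2 E) := by
  have := Measure.isProbabilityMeasure_map (μ := Measure.pi fun i => gaussian (E i))
    (f := WithLp.toLp 2) (by fun_prop)
  refine Measure.ext_of_charFun (funext fun t => ?_)
  simp_rw [charFun_pi, charFun_gaussian, ← Complex.exp_sum, ← Finset.sum_div,
    Finset.sum_neg_distrib]
  norm_cast
  rw [PiLp.norm_sq_eq_of_L2]

end Gaussian

section ComplexGaussian

open Matrix

variable {ι κ : Type*} [Fintype ι] [Fintype κ]

instance : IsProbabilityMeasure stdComplexGaussian :=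
  gaussian_complex ▸ inferInstance

variable (ι) in
/-- The law of a vector of independent standard complex Gaussian variables. -/
def gaussianVector : Measure (ι → ℂ) :=
  Measure.pi fun _ => stdComplexGaussian

instance : IsProbabilityMeasure (gaussianVector ι) := by
  unfold gaussianVector
  infer_instance

lemma map_toLp_gaussianVector :
    (gaussianVector ι).map (WithLp.toLp 2) = gaussian (EuclideanSpace ℂ ι) := by
  rw [gaussianVector, ← gaussian_complex, map_toLp_pi_gaussian]

lemma euclideanSpace_real_inner_eq_re_inner (x y : EuclideanSpace ℂ ι) :
    inner ℝ x y = (inner ℂ x y).re := by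
  simp [PiLp.inner_apply, Complex.inner, mul_comm]

lemma map_mulVec_gaussianVector [DecidableEq κ] {W : Matrix κ ι ℂ} {s : ℝ}
    (hW : W * Wᴴ = ((s ^ 2 : ℝ) : ℂ) • 1) :
    (gaussianVector ι).map (W *ᵥ ·) = (gaussianVector κ).map (s • ·) := by
  classical
  have hadj (x : EuclideanSpace ℂ ι) (t : EuclideanSpace ℂ κ) :
      inner ℂ (toEuclideanLin W x) t = inner ℂ x (toEuclideanLin Wᴴ t) := by
    rw [toEuclideanLin_conjTranspose_eq_adjoint, LinearMap.adjoint_inner_right]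
  have hnorm (t : EuclideanSpace ℂ κ) : ‖toEuclideanLin Wᴴ t‖ = ‖s • t‖ := by
    have hWW : toEuclideanLin W (toEuclideanLin Wᴴ t) = ((s ^ 2 : ℝ) : ℂ) • t := by
      rw [toLpLin_apply, toLpLin_apply, mulVec_mulVec, hW, smul_mulVec, one_mulVec]
      rfl
    have hsq : ‖toEuclideanLin Wᴴ t‖ ^ 2 = ‖s • t‖ ^ 2 := by
      rw [norm_smul, mul_pow, Real.norm_eq_abs, sq_abs, ← inner_self_eq_norm_sq (𝕜 := ℂ), ← hadj,
        hWW, inner_smul_left, Complex.conj_ofReal, RCLike.re_to_complex, Complex.re_ofReal_mul,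
        ← RCLike.re_to_complex, inner_self_eq_norm_sq]
    exact (sq_eq_sq₀ (norm_nonneg _) (norm_nonneg _)).1 hsq
  have h := map_gaussian_eq_map_smul (Φ := toEuclideanLin W) (Ψ := toEuclideanLin Wᴴ) (s := s)
    (LinearMap.continuous_of_finiteDimensional _).measurable
    (fun x t => by simp only [euclideanSpace_real_inner_eq_re_inner, hadj]) hnorm
  rw [← map_toLp_gaussianVector, ← map_toLp_gaussianVector] at h
  apply (MeasurableEquiv.toLp 2 (κ → ℂ)).map_measurableEquiv_injective
  rwa [Measure.map_map (by fun_prop) (by fun_prop), Measure.map_map (by fun_prop) (by fun_prop)]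
    at h ⊢

end ComplexGaussian

section GammaLaw

open Set

lemma gammaMeasure_one_eq_withDensity (a : ℝ) :
    gammaMeasure a 1 = (volume.restrict (Ioi 0)).withDensity fun t =>
      ENNReal.ofReal (t ^ (a - 1) * Real.exp (-t) / Real.Gamma a) := by
  have h : gammaPDF a 1 = (Ici 0).indicator fun t =>
      ENNReal.ofReal (t ^ (a - 1) * Real.exp (-t) / Real.Gamma a) := by
    ext t
    by_cases ht : 0 ≤ t
    · rw [gammaPDF_of_nonneg ht, indicator_of_mem (mem_Ici.2 ht), Real.one_rpow, one_mul]
      congr 1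
      ring
    · rw [gammaPDF_of_neg (not_le.1 ht), indicator_of_notMem (by simpa using ht)]
  rw [gammaMeasure, h, withDensity_indicator measurableSet_Ici, restrict_Ioi_eq_restrict_Ici]

lemma integral_gammaMeasure {a : ℝ} (ha : 0 < a) (f : ℝ → ℝ) :
    ∫ t, f t ∂gammaMeasure a 1 =
      (∫ t in Ioi 0, t ^ (a - 1) * Real.exp (-t) * f t) / Real.Gamma a := by
  have := Real.Gamma_pos_of_pos ha
  rw [gammaMeasure_one_eq_withDensity, integral_withDensity_eq_integral_toReal_smul (by fun_prop)
    (by simp), ← integral_div]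
  refine setIntegral_congr_fun measurableSet_Ioi fun t (ht : 0 < t) => ?_
  rw [ENNReal.toReal_ofReal (by positivity), smul_eq_mul]
  ring

lemma integrable_gammaMeasure {a : ℝ} (ha : 0 < a) {f : ℝ → ℝ}
    (hf : IntegrableOn (fun t => t ^ (a - 1) * Real.exp (-t) * f t) (Ioi 0)) :
    Integrable f (gammaMeasure a 1) := by
  have := Real.Gamma_pos_of_pos ha
  rw [gammaMeasure_one_eq_withDensity,
    integrable_withDensity_iff_integrable_smul' (by fun_prop) (by simp)]
  refine IntegrableOn.congr_fun (Integrable.div_const hf (Real.Gamma a))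
    (fun t (ht : 0 < t) => ?_) measurableSet_Ioi
  rw [ENNReal.toReal_ofReal (by positivity), smul_eq_mul]
  ring

lemma ae_pos_gammaMeasure (a : ℝ) : ∀ᵐ t ∂gammaMeasure a 1, 0 < t := by
  rw [gammaMeasure_one_eq_withDensity]
  exact (withDensity_absolutelyContinuous _ _).ae_le (ae_restrict_mem measurableSet_Ioi)

lemma integral_id_gammaMeasure {a : ℝ} (ha : 0 < a) : ∫ t, t ∂gammaMeasure a 1 = a := by
  have hΓ : Real.Gamma a ≠ 0 := (Real.Gamma_pos_of_pos ha).ne'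
  rw [integral_gammaMeasure ha, div_eq_iff hΓ, ← Real.Gamma_add_one ha.ne',
    Real.Gamma_eq_integral (by positivity)]
  refine setIntegral_congr_fun measurableSet_Ioi fun t (ht : 0 < t) => ?_
  rw [add_sub_cancel_right, Real.rpow_sub_one ht.ne']
  field_simp

variable {E : Type*} [NormedAddCommGroup E] [InnerProductSpace ℝ E] [FiniteDimensional ℝ E]
  [MeasurableSpace E] [BorelSpace E]

lemma exists_integral_comp_sq_norm_gaussian_eq_mul [Nontrivial E] :
    ∃ C : ℝ, ∀ f : ℝ → ℝ, ∫ x, f (‖x‖ ^ 2) ∂gaussian E =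
      C * ∫ t in Ioi 0, t ^ (finrank ℝ E / 2 - 1 : ℝ) * Real.exp (-t) * f t := by
  set n := finrank ℝ E with hn
  have hn1 : 1 ≤ n := finrank_pos
  refine ⟨n * volume.real (Metric.ball (0 : E) 1) / (2 * Real.pi ^ (n / 2 : ℝ)), fun f => ?_⟩
  rw [integral_gaussian, ← hn, integral_fun_norm_addHaar volume
    (fun r => (Real.exp (-r ^ 2) / Real.pi ^ (n / 2 : ℝ)) • f (r ^ 2)), ← hn,
    ← integral_comp_rpow_Ioi_of_pos
      (g := fun t => t ^ (n / 2 - 1 : ℝ) * Real.exp (-t) * f t) two_pos,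
    nsmul_eq_mul, smul_eq_mul, ← mul_assoc, ← integral_const_mul, ← integral_const_mul]
  refine setIntegral_congr_fun measurableSet_Ioi fun y (hy : 0 < y) => ?_
  have hpow : y ^ (n - 1) = (y ^ 2) ^ (n / 2 - 1 : ℝ) * y := by
    rw [← Real.rpow_natCast y 2, ← Real.rpow_mul hy.le, ← Real.rpow_add_one hy.ne',
      ← Real.rpow_natCast, Nat.cast_sub hn1]
    congr 1
    push_cast
    ring
  have h2 : y ^ (2 - 1 : ℝ) = y := by norm_num
  simp only [Real.rpow_two, hpow, smul_eq_mul, h2]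
  field_simp

lemma map_sq_norm_gaussian [Nontrivial E] :
    (gaussian E).map (fun x => ‖x‖ ^ 2) = gammaMeasure (finrank ℝ E / 2) 1 := by
  have ha : 0 < (finrank ℝ E / 2 : ℝ) := by
    have : 0 < finrank ℝ E := finrank_pos
    positivity
  have := isProbabilityMeasure_gammaMeasure ha one_pos
  obtain ⟨C, hC⟩ := exists_integral_comp_sq_norm_gaussian_eq_mul (E := E)
  have hCΓ : 1 = C * Real.Gamma (finrank ℝ E / 2) := by
    simpa [Real.Gamma_eq_integral ha, mul_comm] using hC 1
  ext s hs
  have hsq : Measurable fun x : E => ‖x‖ ^ 2 := by fun_prop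
  rw [Measure.map_apply hsq hs, ← measureReal_eq_measureReal_iff, ← integral_indicator_one (hsq hs),
    ← integral_indicator_one hs, integral_gammaMeasure ha,
    eq_div_iff (Real.Gamma_pos_of_pos ha).ne']
  calc _ = (∫ x, s.indicator 1 (‖x‖ ^ 2) ∂gaussian E) * Real.Gamma (finrank ℝ E / 2) := rfl
    _ = _ := by rw [hC, mul_right_comm, ← hCΓ, one_mul]

lemma map_sum_sq_norm_gaussianVector {ι : Type*} [Fintype ι] [Nonempty ι] :
    (gaussianVector ι).map (fun g => ∑ i, ‖g i‖ ^ 2) = gammaMeasure (Fintype.card ι) 1 := by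
  have hdim : (finrank ℝ (EuclideanSpace ℂ ι) / 2 : ℝ) = Fintype.card ι := by
    rw [← finrank_mul_finrank ℝ ℂ, Complex.finrank_real_complex, finrank_euclideanSpace]
    simp
  rw [← hdim, ← map_sq_norm_gaussian, ← map_toLp_gaussianVector,
    Measure.map_map (by fun_prop) (by fun_prop)]
  simp [Function.comp_def, EuclideanSpace.norm_sq_eq]

end GammaLaw

section LogGamma

open Set

lemma integrable_log_gammaMeasure {a : ℝ} (ha : 0 < a) :
    Integrable Real.log (gammaMeasure a 1) := by
  refine integrable_gammaMeasure ha ?_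
  have h := (mellin_hasDerivAt_of_isBigO_rpow (E := ℂ) (f := fun t => (Real.exp (-t) : ℂ))
    (a := a + 1) (b := 0) (s := a) ?_ ?_ (by simp) ?_ (by simpa)).1
  · refine IntegrableOn.congr_fun (Integrable.re h) (fun t (ht : 0 < t) => ?_) measurableSet_Ioi
    have hpow : (t : ℂ) ^ (a - 1 : ℂ) = (t ^ (a - 1) : ℝ) := by
      rw [Complex.ofReal_cpow ht.le]
      push_cast
      rfl
    simp only [hpow, Complex.real_smul, smul_eq_mul, RCLike.re_to_complex, Complex.re_ofReal_mul,
      Complex.ofReal_re]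
    ring
  · exact ContinuousOn.locallyIntegrableOn (by fun_prop) measurableSet_Ioi
  · rw [← Asymptotics.isBigO_norm_left]
    simp_rw [Complex.norm_real, Asymptotics.isBigO_norm_left]
    simpa only [neg_one_mul] using (isLittleO_exp_neg_mul_rpow_atTop zero_lt_one _).isBigO
  · simp_rw [neg_zero, Real.rpow_zero]
    have hc : Continuous fun t : ℝ => (Real.exp (-t) : ℂ) := by fun_prop
    exact (hc.tendsto 0 |>.mono_left nhdsWithin_le_nhds).isBigO_one ℝ

lemma hasDerivAt_Gamma_eq_integral {a : ℝ} (ha : 0 < a) :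
    HasDerivAt Real.Gamma (∫ t in Ioi 0, t ^ (a - 1) * Real.exp (-t) * Real.log t) a := by
  have hΓ : HasDerivAt Complex.Gamma _ (a : ℂ) :=
    (Complex.hasDerivAt_GammaIntegral (s := a) (by simpa)).congr_of_eventuallyEq <| by
      filter_upwards [(isOpen_lt continuous_const Complex.continuous_re).mem_nhds
        (show 0 < (a : ℂ).re by simpa)] with s hs using Complex.Gamma_eq_integral hs
  refine hΓ.real_of_complex.congr_deriv ?_
  rw [← Complex.ofReal_re (∫ t in Ioi 0, t ^ (a - 1) * Real.exp (-t) * Real.log t),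
    ← integral_complex_ofReal]
  congr 1
  refine setIntegral_congr_fun measurableSet_Ioi fun t (ht : 0 < t) => ?_
  push_cast [Complex.ofReal_cpow ht.le]
  ring

lemma integral_log_gammaMeasure {a : ℝ} (ha : 0 < a) :
    ∫ t, Real.log t ∂gammaMeasure a 1 = digamma a := by
  rw [integral_gammaMeasure ha, digamma, logDeriv_apply, (hasDerivAt_Gamma_eq_integral ha).deriv]

end LogGamma

section LogMean

lemma map_prod_eq_of_ae_map_eq {α β γ : Type*} [MeasurableSpace α] [MeasurableSpace β]
    [MeasurableSpace γ] {μ : Measure α} {τ : Measure β} [SFinite μ] [IsProbabilityMeasure τ]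
    {ν : Measure γ} {F : α × β → γ} (hF : Measurable F)
    (h : ∀ᵐ y ∂τ, μ.map (fun x => F (x, y)) = ν) : (μ.prod τ).map F = ν := by
  ext s hs
  calc (μ.prod τ).map F s = ∫⁻ y, μ.map (fun x => F (x, y)) s ∂τ := by
        rw [Measure.map_apply hF hs, Measure.prod_apply_symm (hF hs)]
        refine lintegral_congr fun y => ?_
        rw [Measure.map_apply (by fun_prop) hs]
        rfl
    _ = ν s := by
        rw [lintegral_congr_ae (h.mono fun y hy => by rw [hy]), lintegral_const, measure_univ,
          mul_one]

/-- A random variable that is almost surely positive and whose logarithm is integrable with mean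
`c`; this is the information on a determinant that is passed from one matrix factor to the next. -/
structure HasLogMean {Ω : Type*} [MeasurableSpace Ω] (P : Measure Ω) (Y : Ω → ℝ) (c : ℝ) :
    Prop where
  ae_pos : ∀ᵐ ω ∂P, 0 < Y ω
  integrable_log : Integrable (fun ω => Real.log (Y ω)) P
  integral_log : ∫ ω, Real.log (Y ω) ∂P = c

namespace HasLogMean

variable {Ω α β : Type*} [MeasurableSpace Ω] [MeasurableSpace α] [MeasurableSpace β]
  {P : Measure Ω} {Y Z : Ω → ℝ} {c d : ℝ}

lemma congr (h : HasLogMean P Y c) (hYZ : Y =ᵐ[P] Z) : HasLogMean P Z c where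
  ae_pos := by filter_upwards [h.ae_pos, hYZ] with ω hω heq using heq ▸ hω
  integrable_log := h.integrable_log.congr (hYZ.fun_comp Real.log)
  integral_log := h.integral_log ▸ integral_congr_ae (hYZ.fun_comp Real.log).symm

lemma mul (hY : HasLogMean P Y c) (hZ : HasLogMean P Z d) :
    HasLogMean P (fun ω => Y ω * Z ω) (c + d) := by
  have hlog : (fun ω => Real.log (Y ω) + Real.log (Z ω)) =ᵐ[P] fun ω => Real.log (Y ω * Z ω) := by
    filter_upwards [hY.ae_pos, hZ.ae_pos] with ω hYω hZω using
      (Real.log_mul hYω.ne' hZω.ne').symm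
  refine ⟨?_, (hY.integrable_log.add hZ.integrable_log).congr hlog, ?_⟩
  · filter_upwards [hY.ae_pos, hZ.ae_pos] with ω hYω hZω using mul_pos hYω hZω
  · rw [← integral_congr_ae hlog, integral_add hY.integrable_log hZ.integrable_log,
      hY.integral_log, hZ.integral_log]

lemma map_iff {X : Ω → α} (hX : AEMeasurable X P) {f : α → ℝ} (hf : Measurable f) :
    HasLogMean (P.map X) f c ↔ HasLogMean P (fun ω => f (X ω)) c := by
  have hlog {Q : Measure α} : AEStronglyMeasurable (fun x => Real.log (f x)) Q :=
    hf.log.aestronglyMeasurable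
  have hpos := ae_map_iff hX (p := fun x => 0 < f x) (measurableSet_lt measurable_const hf)
  have hint := integrable_map_measure hlog hX
  have heq := integral_map hX hlog
  exact ⟨fun h => ⟨hpos.1 h.1, hint.1 h.2, heq ▸ h.3⟩, fun h => ⟨hpos.2 h.1, hint.2 h.2, heq ▸ h.3⟩⟩

lemma comp_hasLaw {μ : Measure α} {X : Ω → α} {f : α → ℝ} (h : HasLogMean μ f c)
    (hX : HasLaw X μ P) (hf : Measurable f) : HasLogMean P (fun ω => f (X ω)) c := by
  rwa [← map_iff hX.aemeasurable hf, hX.map_eq]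

/-- The ratio `F / D` has law `ν` under the product measure as well, and means of logarithms add
without any appeal to independence. -/
lemma prod {μ : Measure α} {τ : Measure β} [IsProbabilityMeasure μ] [IsProbabilityMeasure τ]
    {ν : Measure ℝ} {F : α × β → ℝ} {D : β → ℝ} (hF : Measurable F) (hD : Measurable D)
    (hν : ∀ y, 0 < D y → μ.map (fun x => F (x, y) / D y) = ν)
    (hc : HasLogMean τ D c) (hd : HasLogMean ν id d) : HasLogMean (μ.prod τ) F (c + d) := by
  have hsnd := (measurePreserving_snd (μ := μ) (ν := τ)).hasLaw
  have hratio : HasLaw (fun z : α × β => F z / D z.2) ν (μ.prod τ) :=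
    ⟨by fun_prop, map_prod_eq_of_ae_map_eq (by fun_prop) (hc.ae_pos.mono hν)⟩
  have hDsnd := hc.comp_hasLaw hsnd hD
  refine (hDsnd.mul (hd.comp_hasLaw hratio measurable_id)).congr ?_
  filter_upwards [hDsnd.ae_pos] with z hz using mul_div_cancel₀ _ hz.ne'

end HasLogMean

lemma hasLogMean_id_gammaMeasure {a : ℝ} (ha : 0 < a) :
    HasLogMean (gammaMeasure a 1) id (digamma a) :=
  ⟨ae_pos_gammaMeasure a, integrable_log_gammaMeasure ha, integral_log_gammaMeasure ha⟩

end LogMean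

section Gram

open Matrix Submodule

variable {𝕜 E : Type*} [RCLike 𝕜] [NormedAddCommGroup E] [InnerProductSpace 𝕜 E] {n : ℕ}

lemma gram_sum_smul {ι κ : Type*} [Fintype ι] (T : Matrix ι κ 𝕜) (v : ι → E) :
    gram 𝕜 (fun j => ∑ i, T i j • v i) = Tᴴ * gram 𝕜 v * T := by
  ext j k
  simp only [gram_apply, sum_inner, inner_sum, inner_smul_left, inner_smul_right, mul_apply,
    conjTranspose_apply, RCLike.star_def, Finset.sum_mul, Finset.mul_sum]
  refine Finset.sum_congr rfl fun i _ => Finset.sum_congr rfl fun l _ => ?_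
  ring

lemma det_gram_cons_of_inner_eq_zero {w : E} {v : Fin n → E} (h : ∀ i, inner 𝕜 w (v i) = 0) :
    (gram 𝕜 (Fin.cons w v : Fin (n + 1) → E)).det = (‖w‖ : 𝕜) ^ 2 * (gram 𝕜 v).det := by
  rw [det_succ_row_zero, Fin.sum_univ_succ]
  simp only [h, gram_apply, Fin.cons_zero, Fin.cons_succ, inner_self_eq_norm_sq_to_K,
    Fin.val_zero, pow_zero, one_mul, mul_zero, zero_mul, Finset.sum_const_zero, add_zero]
  rfl

lemma det_gram_cons_add_of_mem_span {u w : E} {v : Fin n → E} (hu : u ∈ span 𝕜 (Set.range v)) :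
    (gram 𝕜 (Fin.cons (w + u) v : Fin (n + 1) → E)).det =
      (gram 𝕜 (Fin.cons w v : Fin (n + 1) → E)).det := by
  obtain ⟨c, rfl⟩ := mem_span_range_iff_exists_fun 𝕜 |>.1 hu
  set T : Matrix (Fin (n + 1)) (Fin (n + 1)) 𝕜 := updateCol 1 0 (Fin.cons 1 c)
  have hT : T.det = 1 := by
    rw [← cramer_apply, cramer_one]
    rfl
  have hcons : (Fin.cons (w + ∑ i, c i • v i) v : Fin (n + 1) → E) =
      fun j => ∑ i, T i j • (Fin.cons w v : Fin (n + 1) → E) i := by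
    ext j
    refine Fin.cases ?_ (fun j => ?_) j
    · simp [T, Fin.sum_univ_succ]
    · simp [T, one_apply]
  rw [hcons, gram_sum_smul, det_mul, det_mul, det_conjTranspose, hT, star_one, one_mul, mul_one]

lemma det_gram_cons (w : E) (v : Fin n → E) [(span 𝕜 (Set.range v)).HasOrthogonalProjection] :
    (gram 𝕜 (Fin.cons w v : Fin (n + 1) → E)).det =
      (‖(span 𝕜 (Set.range v))ᗮ.orthogonalProjectionOnto w‖ : 𝕜) ^ 2 * (gram 𝕜 v).det := by
  set S := span 𝕜 (Set.range v)
  have hperp (i : Fin n) : inner 𝕜 (Sᗮ.starProjection w) (v i) = 0 :=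
    inner_left_of_mem_orthogonal (subset_span (Set.mem_range_self i)) (starProjection_apply_mem _ w)
  have hw : w = Sᗮ.starProjection w + S.starProjection w := by
    rw [add_comm, starProjection_add_starProjection_orthogonal]
  conv_lhs => rw [hw]
  rw [det_gram_cons_add_of_mem_span (starProjection_apply_mem _ w),
    det_gram_cons_of_inner_eq_zero hperp]
  rfl

end Gram

section GaussianVector

open Matrix

variable {ι κ : Type*} [Fintype ι] [Fintype κ]

lemma map_inner_gaussianVector {b : κ → EuclideanSpace ℂ ι} (hb : Orthonormal ℂ b) :
    (gaussianVector ι).map (fun g k => inner ℂ (b k) (WithLp.toLp 2 g)) = gaussianVector κ := by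
  classical
  have hW : (of fun k i => star (b k i)) * (of fun k i => star (b k i))ᴴ =
      (((1 : ℝ) ^ 2 : ℝ) : ℂ) • (1 : Matrix κ κ ℂ) := by
    rw [one_pow, Complex.ofReal_one, one_smul, ← gram_eq_one_iff_orthonormal.2 hb]
    ext k l
    simp [mul_apply, PiLp.inner_apply, mul_comm]
  have h := map_mulVec_gaussianVector hW
  simp only [one_smul, Measure.map_id'] at h
  rw [← h]
  congr with g k
  simp [mulVec, dotProduct, PiLp.inner_apply, mul_comm]

lemma map_sq_norm_orthogonalProjectionOnto {S : Submodule ℂ (EuclideanSpace ℂ ι)} (hS : S ≠ ⊥) :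
    (gaussianVector ι).map (fun g => ‖S.orthogonalProjectionOnto (WithLp.toLp 2 g)‖ ^ 2) =
      gammaMeasure (finrank ℂ S) 1 := by
  set b := stdOrthonormalBasis ℂ S
  have : Nonempty (Fin (finrank ℂ S)) :=
    Fin.pos_iff_nonempty.1 (Nat.pos_of_ne_zero (mt Submodule.finrank_eq_zero.1 hS))
  have hnorm (g : ι → ℂ) : ‖S.orthogonalProjectionOnto (WithLp.toLp 2 g)‖ ^ 2 =
      ∑ k, ‖inner ℂ (b k : EuclideanSpace ℂ ι) (WithLp.toLp 2 g)‖ ^ 2 := by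
    rw [← b.sum_sq_norm_inner_right]
    refine Finset.sum_congr rfl fun k _ => ?_
    rw [← S.inner_orthogonalProjectionOnto_eq_of_mem_left]
  have hb := map_inner_gaussianVector (b.orthonormal.comp_linearIsometry S.subtypeₗᵢ)
  have h := map_sum_sq_norm_gaussianVector (ι := Fin (finrank ℂ S))
  rw [Fintype.card_fin, ← hb, Measure.map_map (by fun_prop) (by fun_prop)] at h
  simp_rw [hnorm]
  exact h

end GaussianVector

section GaussianMatrix

open Matrix

variable {m n ι : Type*}

instance : MeasurableSpace (Matrix m n ℂ) := MeasurableSpace.pi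

instance [Finite m] [Finite n] : BorelSpace (Matrix m n ℂ) :=
  inferInstanceAs (BorelSpace (m → n → ℂ))

@[fun_prop]
lemma measurable_matrix_mul [Fintype n] {Ω : Type*} [MeasurableSpace Ω] {X : Ω → Matrix m n ℂ}
    {Y : Ω → Matrix n ι ℂ} (hX : Measurable X) (hY : Measurable Y) :
    Measurable fun ω => X ω * Y ω :=
  measurable_pi_iff.2 fun i => measurable_pi_iff.2 fun j => by
    simp only [mul_apply]
    fun_prop

variable [Fintype m] [Fintype n] [Fintype ι]

variable (m n) in
/-- The law of a matrix with independent standard complex Gaussian entries. -/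
def gaussianMatrix : Measure (Matrix m n ℂ) :=
  Measure.pi fun _ : m => gaussianVector n

instance : IsProbabilityMeasure (gaussianMatrix m n) :=
  inferInstanceAs (IsProbabilityMeasure (Measure.pi fun _ : m => gaussianVector n))

lemma map_curry_gaussianVector :
    (gaussianVector (m × n)).map (fun x => of fun i j => x (i, j)) = gaussianMatrix m n := by
  have h := Measure.infinitePi_map_curry fun (_ : m) (_ : n) => stdComplexGaussian
  simp only [Measure.infinitePi_eq_pi] at h
  exact h

lemma hasLaw_gaussianMatrix {Ω : Type*} [MeasurableSpace Ω] {P : Measure Ω}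
    {X : Ω → Matrix m n ℂ} (hX : ∀ i j, HasLaw (fun ω => X ω i j) stdComplexGaussian P)
    (hind : iIndepFun (fun (e : m × n) ω => X ω e.1 e.2) P) :
    HasLaw X (gaussianMatrix m n) P := by
  have hentries : HasLaw (fun ω (e : m × n) => X ω e.1 e.2) (gaussianVector (m × n)) P :=
    hind.hasLaw_pi fun e => hX e.1 e.2
  have hcurry : HasLaw (fun x => of fun i j => x (i, j)) (gaussianMatrix m n)
      (gaussianVector (m × n)) :=
    ⟨(MeasurableEquiv.curry m n ℂ).measurable.aemeasurable, map_curry_gaussianVector⟩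
  exact hcurry.comp hentries

lemma map_transpose_gaussianMatrix :
    (gaussianMatrix m n).map transpose = gaussianMatrix n m := by
  have hind : iIndepFun (fun (e : m × n) x => x e) (gaussianVector (m × n)) :=
    iIndepFun_pi (X := fun _ => id) fun _ => aemeasurable_id
  have h : HasLaw (fun x => of fun i j => x (j, i)) (gaussianMatrix n m)
      (gaussianVector (m × n)) := hasLaw_gaussianMatrix
    (fun i j => (measurePreserving_eval (fun _ => stdComplexGaussian) (j, i)).hasLaw)
    (hind.precomp (Equiv.prodComm n m).injective)
  rw [← h.map_eq, ← map_curry_gaussianVector, Measure.map_map (by fun_prop) (by fun_prop)]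
  rfl

lemma measurable_det_gram_toLp [DecidableEq m] :
    Measurable fun A : Matrix m ι ℂ => (gram ℂ fun i => WithLp.toLp 2 (A i)).det := by
  have hgram : Continuous fun A : Matrix m ι ℂ => gram ℂ fun i => WithLp.toLp 2 (A i) :=
    continuous_matrix fun i j => by
      simp only [gram_apply]
      fun_prop
  exact hgram.matrix_det.measurable

lemma map_norm_det_gram_cons_div_gaussianVector {n : ℕ} {v : Fin n → EuclideanSpace ℂ ι}
    (hn : n < Fintype.card ι) (hv : LinearIndependent ℂ v) :
    (gaussianVector ι).map (fun g => ‖(gram ℂ (Fin.cons (WithLp.toLp 2 g) v :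
      Fin (n + 1) → EuclideanSpace ℂ ι)).det‖ / ‖(gram ℂ v).det‖) =
        gammaMeasure (Fintype.card ι - n) 1 := by
  set S := Submodule.span ℂ (Set.range v)
  have hfinrank : finrank ℂ Sᗮ = Fintype.card ι - n := by
    have h := S.finrank_add_finrank_orthogonal
    rw [finrank_span_eq_card hv, Fintype.card_fin, finrank_euclideanSpace] at h
    exact Nat.eq_sub_of_add_eq' h
  have hS : Sᗮ ≠ ⊥ := fun h => by
    rw [h, finrank_bot] at hfinrank
    exact (Nat.sub_pos_of_lt hn).ne hfinrank
  have hdet : ‖(gram ℂ v).det‖ ≠ 0 :=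
    norm_ne_zero_iff.2 (det_gram_ne_zero_iff_linearIndependent.2 hv)
  simp_rw [det_gram_cons, norm_mul, norm_pow, RCLike.norm_ofReal, abs_norm,
    mul_div_cancel_right₀ _ hdet]
  rw [map_sq_norm_orthogonalProjectionOnto hS, hfinrank, Nat.cast_sub hn.le]

lemma hasLogMean_det_gram_gaussianMatrix {n : ℕ} (hn : n ≤ Fintype.card ι) :
    HasLogMean (gaussianMatrix (Fin n) ι) (fun A => ‖(gram ℂ fun i => WithLp.toLp 2 (A i)).det‖)
      (∑ l ∈ Finset.range n, digamma (Fintype.card ι - l)) := by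
  induction n with
  | zero => exact ⟨by simp, by simp, by simp⟩
  | succ n ih =>
    have hcons (g : ι → ℂ) (A : Matrix (Fin n) ι ℂ) :
        (fun i => WithLp.toLp 2
          ((MeasurableEquiv.piFinSuccAbove (fun _ : Fin (n + 1) => ι → ℂ) 0).symm (g, A) i)) =
          (Fin.cons (WithLp.toLp 2 g) fun i => WithLp.toLp 2 (A i) :
            Fin (n + 1) → EuclideanSpace ℂ ι) := by
      ext i : 1
      exact Fin.cases rfl (fun _ => rfl) i
    have hmap := measurePreserving_piFinSuccAbove (fun _ : Fin (n + 1) => gaussianVector ι) 0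
      |>.symm
    change HasLogMean (Measure.pi fun _ : Fin (n + 1) => gaussianVector ι) _ _
    rw [← hmap.map_eq, HasLogMean.map_iff hmap.aemeasurable measurable_det_gram_toLp.norm,
      Finset.sum_range_succ]
    refine .prod ?_ measurable_det_gram_toLp.norm (fun A hA => ?_) (ih (by lia))
      (hasLogMean_id_gammaMeasure (sub_pos.2 (mod_cast hn)))
    · exact measurable_det_gram_toLp.norm.comp hmap.measurable
    · have hv := det_gram_ne_zero_iff_linearIndependent.1 (norm_pos_iff.1 hA)
      rw [← map_norm_det_gram_cons_div_gaussianVector hn hv]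
      exact congrArg (Measure.map · _) (funext fun g =>
        congrArg (fun v => ‖(gram ℂ v).det‖ / _) (hcons g A))

end GaussianMatrix

section GramDet

open Matrix

variable {m n r : Type*} [Fintype m] [Fintype n] [Fintype r] [DecidableEq r]

/-- The Gram determinant `det (A† A)` of the columns of `A`. It is a nonnegative real number, so it
equals its modulus. -/
def gramDet (A : Matrix m r ℂ) : ℝ := ‖(Aᴴ * A).det‖

lemma measurable_gramDet : Measurable (gramDet : Matrix m r ℂ → ℝ) := by
  have h : Continuous (gramDet : Matrix m r ℂ → ℝ) := by
    unfold gramDet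
    fun_prop
  exact h.measurable

lemma gramDet_mul_square (A : Matrix m r ℂ) (B : Matrix r r ℂ) :
    gramDet (A * B) = gramDet A * gramDet B := by
  simp only [gramDet, conjTranspose_mul]
  rw [Matrix.mul_assoc, ← Matrix.mul_assoc Aᴴ]
  simp only [det_mul, norm_mul]
  ring

lemma gramDet_eq_one {U : Matrix m r ℂ} (hU : Uᴴ * U = 1) : gramDet U = 1 := by
  rw [gramDet, hU, det_one, norm_one]

lemma exists_eq_mul_of_gramDet_ne_zero {A : Matrix m r ℂ} (hA : gramDet A ≠ 0) :
    ∃ (U : Matrix m r ℂ) (B : Matrix r r ℂ), Uᴴ * U = 1 ∧ A = U * B := by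
  obtain ⟨B, hB⟩ : ∃ B : Matrix r r ℂ, Aᴴ * A = Bᴴ * B := by
    open scoped MatrixOrder ComplexOrder in
    exact CStarAlgebra.nonneg_iff_eq_star_mul_self.1
      (nonneg_iff_posSemidef.2 (posSemidef_conjTranspose_mul_self A))
  have hdet : IsUnit B.det := by
    rw [isUnit_iff_ne_zero]
    rintro h0
    rw [gramDet, hB, det_mul, h0, mul_zero, norm_zero] at hA
    exact hA rfl
  refine ⟨A * B⁻¹, B, ?_, ?_⟩
  · rw [conjTranspose_mul, Matrix.mul_assoc, ← Matrix.mul_assoc Aᴴ, hB, Matrix.mul_assoc Bᴴ,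
      mul_nonsing_inv _ hdet, Matrix.mul_one, ← conjTranspose_mul, mul_nonsing_inv _ hdet,
      conjTranspose_one]
  · rw [Matrix.mul_assoc, nonsing_inv_mul _ hdet, Matrix.mul_one]

lemma gramDet_transpose (A : Matrix r m ℂ) :
    gramDet Aᵀ = ‖(gram ℂ fun i => WithLp.toLp 2 (A i)).det‖ := by
  rw [gramDet]
  congr 2
  ext i j
  simp [mul_apply, gram_apply, PiLp.inner_apply, mul_comm]

lemma map_mul_gaussianMatrix {U : Matrix n r ℂ} (hU : Uᴴ * U = 1) :
    (gaussianMatrix m n).map (· * U) = gaussianMatrix m r := by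
  have hW : Uᵀ * Uᵀᴴ = (((1 : ℝ) ^ 2 : ℝ) : ℂ) • 1 := by
    rw [one_pow, Complex.ofReal_one, one_smul, ← transpose_one, ← hU, transpose_mul]
    rfl
  have hrow : (gaussianVector n).map (Uᵀ *ᵥ ·) = gaussianVector r := by
    simpa only [one_smul, Measure.map_id'] using map_mulVec_gaussianVector hW
  have := Measure.pi_map_pi (μ := fun _ : m => gaussianVector n) (f := fun _ => (Uᵀ *ᵥ ·))
    fun _ => by fun_prop
  simp only [hrow] at this
  simp only [mulVec_transpose] at this
  exact this

variable {k : ℕ}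

lemma hasLogMean_gramDet_gaussianMatrix (hk : k ≤ Fintype.card m) :
    HasLogMean (gaussianMatrix m (Fin k)) gramDet
      (∑ l ∈ Finset.range k, digamma (Fintype.card m - l)) := by
  rw [← map_transpose_gaussianMatrix, HasLogMean.map_iff (by fun_prop) measurable_gramDet]
  simp_rw [gramDet_transpose]
  exact hasLogMean_det_gram_gaussianMatrix hk

lemma hasLogMean_gramDet_mul {τ : Measure (Matrix n (Fin k) ℂ)} [IsProbabilityMeasure τ] {c : ℝ}
    (hτ : HasLogMean τ gramDet c) (hk : k ≤ Fintype.card m) :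
    HasLogMean ((gaussianMatrix m n).prod τ) (fun z => gramDet (z.1 * z.2))
      (c + ∑ l ∈ Finset.range k, digamma (Fintype.card m - l)) := by
  have hid : HasLogMean ((gaussianMatrix m (Fin k)).map gramDet) id
      (∑ l ∈ Finset.range k, digamma (Fintype.card m - l)) :=
    (HasLogMean.map_iff measurable_gramDet.aemeasurable measurable_id).2
      (hasLogMean_gramDet_gaussianMatrix hk)
  refine .prod ?_ measurable_gramDet (fun A hA => ?_) hτ hid
  · exact measurable_gramDet.comp (measurable_matrix_mul measurable_fst measurable_snd)
  · obtain ⟨U, B, hU, rfl⟩ := exists_eq_mul_of_gramDet_ne_zero hA.ne'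
    rw [gramDet_mul_square, gramDet_eq_one hU, one_mul] at hA ⊢
    simp_rw [← Matrix.mul_assoc, gramDet_mul_square, mul_div_cancel_right₀ _ hA.ne']
    rw [← map_mul_gaussianMatrix hU, Measure.map_map measurable_gramDet (by fun_prop)]
    rfl

end GramDet

section SecondMoment

open Matrix
open scoped ENNReal

variable {m n r : Type*} [Fintype m] [Fintype n] [Fintype r]

lemma lintegral_enorm_sq_stdComplexGaussian : ∫⁻ z, ‖z‖ₑ ^ 2 ∂stdComplexGaussian = 1 := by
  have hmap := map_sq_norm_gaussian (E := ℂ)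
  rw [gaussian_complex, Complex.finrank_real_complex, Nat.cast_two, div_self two_ne_zero] at hmap
  have hint : Integrable id (gammaMeasure 1 1) := .of_integral_ne_zero <| by
    simp only [id, integral_id_gammaMeasure one_pos, ne_eq, one_ne_zero, not_false_eq_true]
  have hmean := ofReal_integral_eq_lintegral_ofReal hint
    ((ae_pos_gammaMeasure 1).mono fun _ ht => ht.le)
  simp only [id, integral_id_gammaMeasure one_pos, ENNReal.ofReal_one] at hmean
  rw [hmean, ← hmap, lintegral_map (by fun_prop) (by fun_prop)]
  simp only [← ofReal_norm, ENNReal.ofReal_pow (norm_nonneg _)]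

lemma lintegral_enorm_sq_dotProduct_gaussianVector (v : n → ℂ) :
    ∫⁻ g, ‖g ⬝ᵥ v‖ₑ ^ 2 ∂gaussianVector n = ∑ i, ‖v i‖ₑ ^ 2 := by
  set s := √(∑ i, ‖v i‖ ^ 2)
  have hs : s ^ 2 = ∑ i, ‖v i‖ ^ 2 := Real.sq_sqrt (by positivity)
  have hW : replicateRow Unit v * (replicateRow Unit v)ᴴ = ((s ^ 2 : ℝ) : ℂ) • 1 := by
    ext
    simp [mul_apply, hs, Complex.mul_conj']
  have heval := measurePreserving_eval (fun _ : Unit => stdComplexGaussian) ()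
  calc ∫⁻ g, ‖g ⬝ᵥ v‖ₑ ^ 2 ∂gaussianVector n
      = ∫⁻ g, ‖g ()‖ₑ ^ 2 ∂(gaussianVector n).map (replicateRow Unit v *ᵥ ·) := by
        rw [lintegral_map (by fun_prop) (by fun_prop)]
        simp [mulVec, dotProduct_comm]
    _ = ∫⁻ g, ‖s • g ()‖ₑ ^ 2 ∂gaussianVector Unit := by
        rw [map_mulVec_gaussianVector hW, lintegral_map (by fun_prop) (by fun_prop)]
        rfl
    _ = ENNReal.ofReal (s ^ 2) := by
        simp only [enorm_smul, mul_pow]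
        rw [lintegral_const_mul _ (by fun_prop), gaussianVector,
          heval.lintegral_comp (f := fun z => ‖z‖ₑ ^ 2) (by fun_prop),
          lintegral_enorm_sq_stdComplexGaussian, mul_one, ← ofReal_norm,
          ← ENNReal.ofReal_pow (norm_nonneg _), Real.norm_eq_abs, sq_abs]
    _ = ∑ i, ‖v i‖ₑ ^ 2 := by
        rw [hs, ENNReal.ofReal_sum_of_nonneg fun _ _ => by positivity]
        simp only [← ofReal_norm, ENNReal.ofReal_pow (norm_nonneg _)]

/-- The squared Frobenius norm `tr (A† A)`. -/
def frobeniusSq (A : Matrix m n ℂ) : ℝ := ∑ i, ∑ j, ‖A i j‖ ^ 2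

lemma frobeniusSq_nonneg (A : Matrix m n ℂ) : 0 ≤ frobeniusSq A := by
  unfold frobeniusSq
  positivity

@[fun_prop]
lemma measurable_frobeniusSq : Measurable (frobeniusSq : Matrix m n ℂ → ℝ) := by
  unfold frobeniusSq
  fun_prop

lemma ofReal_frobeniusSq (A : Matrix m n ℂ) :
    ENNReal.ofReal (frobeniusSq A) = ∑ i, ∑ j, ‖A i j‖ₑ ^ 2 := by
  rw [frobeniusSq, ENNReal.ofReal_sum_of_nonneg fun _ _ => by positivity]
  refine Finset.sum_congr rfl fun i _ => ?_
  rw [ENNReal.ofReal_sum_of_nonneg fun _ _ => by positivity]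
  simp only [← ofReal_norm, ENNReal.ofReal_pow (norm_nonneg _)]

lemma lintegral_frobeniusSq_mul_gaussianMatrix (A : Matrix n r ℂ) :
    ∫⁻ X, ENNReal.ofReal (frobeniusSq (X * A)) ∂gaussianMatrix m n =
      Fintype.card m * ENNReal.ofReal (frobeniusSq A) := by
  have hrow (i : m) (j : r) : ∫⁻ X, ‖(X * A) i j‖ₑ ^ 2 ∂gaussianMatrix m n =
      ∑ l, ‖A l j‖ₑ ^ 2 := by
    rw [← lintegral_enorm_sq_dotProduct_gaussianVector fun l => A l j]
    exact (measurePreserving_eval (fun _ : m => gaussianVector n) i).lintegral_comp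
      (f := fun g => ‖g ⬝ᵥ fun l => A l j‖ₑ ^ 2) (by unfold dotProduct; fun_prop)
  have hmeas (i : m) (j : r) : Measurable fun X : Matrix m n ℂ => ‖(X * A) i j‖ₑ ^ 2 := by
    simp only [mul_apply]
    fun_prop
  simp only [ofReal_frobeniusSq]
  rw [lintegral_finsetSum _ fun i _ => Finset.measurable_sum _ fun j _ => hmeas i j]
  simp_rw [lintegral_finsetSum _ fun j _ => hmeas _ j, hrow]
  rw [Finset.sum_const, Finset.sum_comm, nsmul_eq_mul, Finset.card_univ]

end SecondMoment

section Eigenvalues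

open Matrix

lemma trace_conjTranspose_mul_self_eq_frobeniusSq {m n : Type*} [Fintype m] [Fintype n]
    (A : Matrix m n ℂ) : (Aᴴ * A).trace = frobeniusSq A := by
  simp only [trace, diag_apply, mul_apply, conjTranspose_apply, frobeniusSq, Complex.star_def,
    Complex.conj_mul']
  rw [Finset.sum_comm]
  norm_cast

lemma det_one_add_smul_eq_prod_eigenvalues {𝕜 n : Type*} [RCLike 𝕜] [Fintype n] [DecidableEq n]
    {A : Matrix n n 𝕜} (hA : A.IsHermitian) (z : 𝕜) :
    (1 + z • A).det = ∏ i, (1 + z * hA.eigenvalues i) := by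
  set U := hA.eigenvectorUnitary
  set D : Matrix n n 𝕜 := diagonal (RCLike.ofReal ∘ hA.eigenvalues)
  have hconj : 1 + z • A = Unitary.conjStarAlgAut 𝕜 _ U (1 + z • D) := by
    rw [map_add, map_one, map_smul, ← hA.spectral_theorem]
  rw [hconj, Unitary.conjStarAlgAut_apply, det_mul_right_comm,
    Unitary.mul_star_self_of_mem U.2, Matrix.one_mul, ← diagonal_one, ← diagonal_smul, diagonal_add,
    det_diagonal]
  rfl

variable {m n : ℕ} (H : Matrix (Fin m) (Fin n) ℂ)

/-- The eigenvalues of `H† H`, i.e. the squared singular values of `H` with multiplicity. -/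
def gramEigenvalues : Fin n → ℝ := (isHermitian_conjTranspose_mul_self H).eigenvalues

lemma gramEigenvalues_nonneg (i : Fin n) : 0 ≤ gramEigenvalues H i :=
  eigenvalues_conjTranspose_mul_self_nonneg H i

lemma sum_gramEigenvalues : ∑ i, gramEigenvalues H i = frobeniusSq H := by
  apply Complex.ofReal_injective
  rw [← trace_conjTranspose_mul_self_eq_frobeniusSq,
    (isHermitian_conjTranspose_mul_self H).trace_eq_sum_eigenvalues, Complex.ofReal_sum]
  rfl

lemma prod_gramEigenvalues : ∏ i, gramEigenvalues H i = gramDet H := by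
  rw [gramDet, (isHermitian_conjTranspose_mul_self H).det_eq_prod_eigenvalues, norm_prod]
  exact Finset.prod_congr rfl fun i _ =>
    (RCLike.norm_of_nonneg (gramEigenvalues_nonneg H i)).symm

variable {H} {q : ℝ}

lemma capacity_eq_sum_log (hq : 0 ≤ q) :
    capacity q H = ∑ i, Real.log (1 + q * gramEigenvalues H i) := by
  have hdet : (1 + (q : ℂ) • (Hᴴ * H)).det = ((∏ i, (1 + q * gramEigenvalues H i) : ℝ) : ℂ) := by
    rw [det_one_add_smul_eq_prod_eigenvalues (isHermitian_conjTranspose_mul_self H)]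
    push_cast
    rfl
  rw [capacity, hdet, Complex.ofReal_re, Real.log_prod]
  intro i _
  have := gramEigenvalues_nonneg H i
  positivity

lemma capacity_nonneg (hq : 0 ≤ q) : 0 ≤ capacity q H := by
  rw [capacity_eq_sum_log hq]
  exact Finset.sum_nonneg fun i _ => Real.log_nonneg <|
    le_add_of_nonneg_right (mul_nonneg hq (gramEigenvalues_nonneg H i))

end Eigenvalues

section Tangents

variable {q t x : ℝ}

lemma log_one_add_mul_le_tangent (hq : 0 ≤ q) (ht : 0 ≤ t) (hx : 0 ≤ x) :
    Real.log (1 + q * x) ≤ Real.log (1 + q * t) + q / (1 + q * t) * (x - t) := by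
  have hbase : 0 < 1 + q * t := by positivity
  have hvalue : 0 < 1 + q * x := by positivity
  have hlog := Real.log_le_sub_one_of_pos (div_pos hvalue hbase)
  rw [Real.log_div hvalue.ne' hbase.ne'] at hlog
  calc Real.log (1 + q * x) ≤ Real.log (1 + q * t) + ((1 + q * x) / (1 + q * t) - 1) := by linarith
    _ = Real.log (1 + q * t) + q / (1 + q * t) * (x - t) := by
      field_simp
      ring

lemma tangent_le_log_one_add_mul (hq : 0 ≤ q) (hx : 0 < x) (c : ℝ) :
    Real.log (1 + q * Real.exp c) +
      q * Real.exp c / (1 + q * Real.exp c) * (Real.log x - c) ≤ Real.log (1 + q * x) := by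
  set b := 1 + q * Real.exp c
  have hbase : 0 < b := by positivity
  have hweights : 1 / b + q * Real.exp c / b = 1 := by rw [← add_div, div_self hbase.ne']
  have hconcave := strictConcaveOn_log_Ioi.concaveOn.2 (Set.mem_Ioi.2 one_pos)
    (Set.mem_Ioi.2 (div_pos hx (Real.exp_pos c))) (by positivity) (by positivity) hweights
  simp only [smul_eq_mul, Real.log_one, mul_zero, zero_add, mul_one] at hconcave
  have hmean : 1 / b + q * Real.exp c / b * (x / Real.exp c) = (1 + q * x) / b := by field_simp
  rw [hmean, Real.log_div (by positivity) hbase.ne', Real.log_div hx.ne' (Real.exp_pos c).ne',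
    Real.log_exp] at hconcave
  linarith

variable {m n : ℕ} {H : Matrix (Fin m) (Fin n) ℂ}

lemma capacity_le_tangent (hq : 0 ≤ q) (ht : 0 ≤ t) :
    capacity q H ≤
      n * Real.log (1 + q * t) + q / (1 + q * t) * (frobeniusSq H - n * t) := by
  rw [capacity_eq_sum_log hq]
  calc ∑ i, Real.log (1 + q * gramEigenvalues H i)
      ≤ ∑ i, (Real.log (1 + q * t) + q / (1 + q * t) * (gramEigenvalues H i - t)) :=
        Finset.sum_le_sum fun i _ =>
          log_one_add_mul_le_tangent hq ht (gramEigenvalues_nonneg H i)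
    _ = n * Real.log (1 + q * t) + q / (1 + q * t) * (frobeniusSq H - n * t) := by
      rw [Finset.sum_add_distrib, ← Finset.mul_sum, Finset.sum_sub_distrib, sum_gramEigenvalues]
      simp

lemma tangent_le_capacity (hq : 0 ≤ q) (hH : 0 < gramDet H) (c : ℝ) :
    n * Real.log (1 + q * Real.exp c) +
      q * Real.exp c / (1 + q * Real.exp c) * (Real.log (gramDet H) - n * c) ≤ capacity q H := by
  rw [← prod_gramEigenvalues] at hH ⊢
  have hne (i : Fin n) : gramEigenvalues H i ≠ 0 :=
    Finset.prod_ne_zero_iff.1 hH.ne' i (Finset.mem_univ i)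
  rw [capacity_eq_sum_log hq, Real.log_prod fun i _ => hne i]
  calc n * Real.log (1 + q * Real.exp c) + q * Real.exp c / (1 + q * Real.exp c) *
        (∑ i, Real.log (gramEigenvalues H i) - n * c)
      = ∑ i, (Real.log (1 + q * Real.exp c) +
          q * Real.exp c / (1 + q * Real.exp c) * (Real.log (gramEigenvalues H i) - c)) := by
        rw [Finset.sum_add_distrib, ← Finset.mul_sum, Finset.sum_sub_distrib]
        simp
    _ ≤ ∑ i, Real.log (1 + q * gramEigenvalues H i) := Finset.sum_le_sum fun i _ =>
      tangent_le_log_one_add_mul hq ((gramEigenvalues_nonneg H i).lt_of_ne' (hne i)) c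

end Tangents

section RandomMatrix

open Matrix

variable {Ω : Type*} [MeasurableSpace Ω] {P : Measure Ω} {m n : ℕ}
  {H : Ω → Matrix (Fin m) (Fin n) ℂ} {q : ℝ}

lemma measurable_capacity (q : ℝ) :
    Measurable (capacity q : Matrix (Fin m) (Fin n) ℂ → ℝ) := by
  have hcont : Continuous fun H : Matrix (Fin m) (Fin n) ℂ =>
      (1 + (q : ℂ) • (H.conjTranspose * H)).det.re := by fun_prop
  exact Real.measurable_log.comp hcont.measurable

lemma integrable_capacity (hH : AEMeasurable H P)
    (hfrob : Integrable (fun ω => frobeniusSq (H ω)) P) (hq : 0 ≤ q) :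
    Integrable (fun ω => capacity q (H ω)) P := by
  refine (hfrob.const_mul q).mono'
    ((measurable_capacity q).comp_aemeasurable hH).aestronglyMeasurable (.of_forall fun ω => ?_)
  rw [Real.norm_of_nonneg (capacity_nonneg hq)]
  simpa using capacity_le_tangent (H := H ω) hq le_rfl

variable [IsProbabilityMeasure P]

lemma integral_const_add_mul_sub {f : Ω → ℝ} (hf : Integrable f P) {μ : ℝ}
    (hμ : ∫ ω, f ω ∂P = μ) (a s : ℝ) : ∫ ω, (a + s * (f ω - μ)) ∂P = a := by
  have hcentered : Integrable (fun ω => f ω - μ) P := hf.sub (integrable_const _)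
  rw [integral_add (integrable_const _) (hcentered.const_mul s),
    integral_const_mul, integral_sub hf (integrable_const _), hμ]
  simp

lemma integral_capacity_le (hH : AEMeasurable H P)
    (hfrob : Integrable (fun ω => frobeniusSq (H ω)) P) {t : ℝ} (ht : 0 ≤ t)
    (hmean : ∫ ω, frobeniusSq (H ω) ∂P = n * t) (hq : 0 ≤ q) :
    ∫ ω, capacity q (H ω) ∂P ≤ n * Real.log (1 + q * t) := by
  rw [← integral_const_add_mul_sub hfrob hmean (n * Real.log (1 + q * t)) (q / (1 + q * t))]
  exact integral_mono (integrable_capacity hH hfrob hq)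
    ((integrable_const _).add ((hfrob.sub (integrable_const _)).const_mul _))
    fun ω => capacity_le_tangent hq ht

lemma le_integral_capacity (hint : Integrable (fun ω => capacity q (H ω)) P) {c : ℝ}
    (hdet : HasLogMean P (fun ω => gramDet (H ω)) (n * c)) (hq : 0 ≤ q) :
    n * Real.log (1 + q * Real.exp c) ≤ ∫ ω, capacity q (H ω) ∂P := by
  rw [← integral_const_add_mul_sub hdet.integrable_log hdet.integral_log
    (n * Real.log (1 + q * Real.exp c)) (q * Real.exp c / (1 + q * Real.exp c))]
  refine integral_mono_ae
    ((integrable_const _).add ((hdet.integrable_log.sub (integrable_const _)).const_mul _)) hint ?_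
  filter_upwards [hdet.ae_pos] with ω hω using tangent_le_capacity hq hω c

end RandomMatrix

section Constants

lemma digamma_natCast_add_one (n : ℕ) :
    digamma ((n : ℝ) + 1) = harmonic n - Real.eulerMascheroniConstant := by
  have hfactorial : (n.factorial : ℝ) ≠ 0 := by positivity
  rw [digamma, logDeriv_apply, Real.deriv_Gamma_nat, Real.Gamma_nat_eq_factorial,
    mul_div_cancel_left₀ _ hfactorial, neg_add_eq_sub]

variable {K : ℕ} {N : Fin (K + 1) → ℕ}

lemma gConst_eq_digamma (hN0 : 1 ≤ N 0) (hmin : ∀ k, N 0 ≤ N k) :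
    gConst N = K * Real.eulerMascheroniConstant +
      (1 / (N 0 : ℝ)) * ∑ k : Fin K, ∑ l ∈ Finset.Icc 1 (N 0),
        digamma ((N k.succ : ℝ) - l + 1) := by
  have hterm (k : Fin K) (l : ℕ) (hl : l ∈ Finset.Icc 1 (N 0)) :
      digamma ((N k.succ : ℝ) - l + 1) =
        ∑ r ∈ Finset.Icc 1 (N k.succ - l), 1 / (r : ℝ) - Real.eulerMascheroniConstant := by
    rw [← Nat.cast_sub ((Finset.mem_Icc.1 hl).2.trans (hmin _)), digamma_natCast_add_one,
      harmonic_eq_sum_Icc]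
    push_cast
    simp only [one_div]
  rw [Finset.sum_congr rfl fun k _ => Finset.sum_congr rfl (hterm k), gConst]
  simp only [Finset.sum_sub_distrib, Finset.sum_const, Nat.card_Icc, Finset.card_univ,
    Fintype.card_fin, nsmul_eq_mul, Nat.add_sub_cancel]
  field_simp
  ring

lemma sum_digamma_eq_gConst (hN0 : 1 ≤ N 0) (hmin : ∀ k, N 0 ≤ N k) :
    ∑ k : Fin K, ∑ l ∈ Finset.range (N 0), digamma (N k.succ - l) =
      N 0 * (gConst N - K * Real.eulerMascheroniConstant) := by
  have hshift (k : Fin K) : ∑ l ∈ Finset.range (N 0), digamma (N k.succ - l) =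
      ∑ l ∈ Finset.Icc 1 (N 0), digamma ((N k.succ : ℝ) - l + 1) := by
    rw [Finset.range_eq_Ico, ← Finset.Ico_succ_right_eq_Icc, Order.succ_eq_add_one,
      ← Finset.sum_Ico_add' _ 0 (N 0) 1]
    refine Finset.sum_congr rfl fun l _ => ?_
    push_cast
    rw [sub_add_eq_sub_sub, sub_add_cancel]
  rw [gConst_eq_digamma hN0 hmin, add_sub_cancel_left, ← mul_assoc,
    mul_one_div_cancel (by positivity), one_mul, Finset.sum_congr rfl fun k _ => hshift k]

end Constants

section Channel

open Matrix
open scoped ENNReal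

variable {K : ℕ} {N : Fin (K + 1) → ℕ}

lemma partialProduct_succ (Q : (k : Fin K) → Matrix (Fin (N k.succ)) (Fin (N k.castSucc)) ℂ)
    (k : Fin K) : partialProduct N Q k.succ = Q k * partialProduct N Q k.castSucc :=
  Fin.induction_succ _ _ _

lemma partialProduct_congr
    {Q Q' : (k : Fin K) → Matrix (Fin (N k.succ)) (Fin (N k.castSucc)) ℂ} {k : Fin (K + 1)}
    (h : ∀ j : Fin K, j.castSucc < k → Q j = Q' j) :
    partialProduct N Q k = partialProduct N Q' k := by
  induction k using Fin.induction with
  | zero => rfl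
  | succ k ih =>
    rw [partialProduct_succ, partialProduct_succ, h k Fin.castSucc_lt_succ,
      ih fun j hj => h j (hj.trans Fin.castSucc_lt_succ)]

lemma measurable_partialProduct (k : Fin (K + 1)) :
    Measurable fun Q : (k : Fin K) → Matrix (Fin (N k.succ)) (Fin (N k.castSucc)) ℂ =>
      partialProduct N Q k := by
  induction k using Fin.induction with
  | zero => exact measurable_const
  | succ k ih =>
    simp only [partialProduct_succ]
    fun_prop

lemma filter_castSucc_lt_succ (k : Fin K) :
    ({j : Fin K | j.castSucc < k.succ} : Finset (Fin K)) =
      insert k ({j : Fin K | j.castSucc < k.castSucc} : Finset (Fin K)) := by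
  ext j
  simp only [Finset.mem_filter, Finset.mem_univ, true_and, Finset.mem_insert,
    Fin.castSucc_lt_succ_iff, Fin.castSucc_lt_castSucc_iff, le_iff_eq_or_lt]

variable {Ω : Type*} [MeasurableSpace Ω] {P : Measure Ω}
  {Q : (k : Fin K) → Ω → Matrix (Fin (N k.succ)) (Fin (N k.castSucc)) ℂ}

namespace IsRayleigh

lemma aemeasurable_partialProduct (hQ : IsRayleigh P N Q) (k : Fin (K + 1)) :
    AEMeasurable (fun ω => partialProduct N (fun j => Q j ω) k) P :=
  (measurable_partialProduct k).comp_aemeasurable <| aemeasurable_pi_lambda _ fun j =>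
    aemeasurable_pi_lambda _ fun _ => aemeasurable_pi_lambda _ fun _ =>
      (hQ.hasLaw j _ _).aemeasurable

lemma hasLaw_gaussianMatrix [IsProbabilityMeasure P] (hQ : IsRayleigh P N Q) (k : Fin K) :
    HasLaw (Q k) (gaussianMatrix (Fin (N k.succ)) (Fin (N k.castSucc))) P :=
  RayleighProduct.hasLaw_gaussianMatrix (hQ.hasLaw k)
    (hQ.indep.precomp (g := Sigma.mk k) sigma_mk_injective)

lemma indepFun_partialProduct (hQ : IsRayleigh P N Q) (k : Fin K) :
    IndepFun (Q k) (fun ω => partialProduct N (fun j => Q j ω) k.castSucc) P := by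
  let present : Finset ((k : Fin K) × (Fin (N k.succ) × Fin (N k.castSucc))) := {e | e.1 = k}
  let past : Finset ((k : Fin K) × (Fin (N k.succ) × Fin (N k.castSucc))) := {e | e.1 < k}
  have hdisj : Disjoint present past :=
    Finset.disjoint_filter.2 fun e _ he => he.not_lt
  have hindep := hQ.indep.indepFun_finset₀ present past hdisj
    fun e => (hQ.hasLaw e.1 e.2.1 e.2.2).aemeasurable
  let readPresent (u : present → ℂ) : Matrix (Fin (N k.succ)) (Fin (N k.castSucc)) ℂ :=
    fun i j => u ⟨⟨k, i, j⟩, by simp [present]⟩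
  let readPast (u : past → ℂ) (l : Fin K) : Matrix (Fin (N l.succ)) (Fin (N l.castSucc)) ℂ :=
    fun i j => if hl : l < k then u ⟨⟨l, i, j⟩, by simpa [past]⟩ else 0
  have hpresent : Measurable readPresent :=
    measurable_pi_lambda _ fun i => measurable_pi_lambda _ fun j => measurable_pi_apply _
  have hpast : Measurable readPast :=
    measurable_pi_lambda _ fun l => measurable_pi_lambda _ fun i =>
      measurable_pi_lambda _ fun j => by
        by_cases hl : l < k <;> simp only [readPast, hl, dite_true, dite_false] <;> fun_prop
  have hpartial (ω : Ω) : partialProduct N (readPast fun e => Q e.1.1 ω e.1.2.1 e.1.2.2)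
      k.castSucc = partialProduct N (fun j => Q j ω) k.castSucc :=
    partialProduct_congr fun l hl => by ext; simp [readPast, Fin.castSucc_lt_castSucc_iff.1 hl]
  exact (hindep.comp hpresent ((measurable_partialProduct k.castSucc).comp hpast)).congr .rfl
    (.of_forall hpartial)

lemma hasLaw_prodMk_partialProduct [IsProbabilityMeasure P] (hQ : IsRayleigh P N Q) (k : Fin K) :
    HasLaw (fun ω => (Q k ω, partialProduct N (fun j => Q j ω) k.castSucc))
      ((gaussianMatrix (Fin (N k.succ)) (Fin (N k.castSucc))).prod
        (P.map fun ω => partialProduct N (fun j => Q j ω) k.castSucc)) P :=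
  (indepFun_iff_hasLaw_prodMk_prod (hQ.hasLaw_gaussianMatrix k)
    ⟨hQ.aemeasurable_partialProduct k.castSucc, rfl⟩).1 (hQ.indepFun_partialProduct k)

lemma hasLogMean_gramDet_partialProduct [IsProbabilityMeasure P] (hQ : IsRayleigh P N Q)
    (hmin : ∀ k, N 0 ≤ N k) (k : Fin (K + 1)) :
    HasLogMean P (fun ω => gramDet (partialProduct N (fun j => Q j ω) k))
      (∑ j : Fin K with j.castSucc < k, ∑ l ∈ Finset.range (N 0), digamma (N j.succ - l)) := by
  induction k using Fin.induction with
  | zero =>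
    have h : gramDet (1 : Matrix (Fin (N 0)) (Fin (N 0)) ℂ) = 1 := gramDet_eq_one (by simp)
    change HasLogMean P (fun _ => gramDet 1) _
    simp only [h]
    exact ⟨by simp, by simp, by simp⟩
  | succ k ih =>
    have hmeas := hQ.aemeasurable_partialProduct k.castSucc
    have := Measure.isProbabilityMeasure_map hmeas
    have hstep := hasLogMean_gramDet_mul (m := Fin (N k.succ))
      ((HasLogMean.map_iff hmeas measurable_gramDet).2 ih)
      ((hmin k.succ).trans_eq (Fintype.card_fin _).symm)
    rw [filter_castSucc_lt_succ, Finset.sum_insert (by simp),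
      add_comm (∑ l ∈ Finset.range (N 0), _)]
    simp only [partialProduct_succ]
    simpa only [Fintype.card_fin] using hstep.comp_hasLaw (hQ.hasLaw_prodMk_partialProduct k)
      (measurable_gramDet.comp (measurable_matrix_mul measurable_fst measurable_snd))

lemma lintegral_frobeniusSq_partialProduct [IsProbabilityMeasure P] (hQ : IsRayleigh P N Q)
    (k : Fin (K + 1)) :
    ∫⁻ ω, ENNReal.ofReal (frobeniusSq (partialProduct N (fun j => Q j ω) k)) ∂P =
      N 0 * ∏ j : Fin K with j.castSucc < k, (N j.succ : ℝ≥0∞) := by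
  induction k using Fin.induction with
  | zero =>
    change ∫⁻ _, ENNReal.ofReal (frobeniusSq 1) ∂P = _
    simp [ofReal_frobeniusSq, one_apply, apply_ite]
  | succ k ih =>
    have hmeas := hQ.aemeasurable_partialProduct k.castSucc
    have := Measure.isProbabilityMeasure_map hmeas
    simp only [partialProduct_succ]
    rw [(hQ.hasLaw_prodMk_partialProduct k).lintegral_comp
      (f := fun z => ENNReal.ofReal (frobeniusSq (z.1 * z.2))) (by fun_prop),
      lintegral_prod_symm _ (by fun_prop)]
    simp only [lintegral_frobeniusSq_mul_gaussianMatrix]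
    rw [lintegral_const_mul _ (by fun_prop), lintegral_map' (by fun_prop) hmeas, ih,
      filter_castSucc_lt_succ, Finset.prod_insert (by simp), Fintype.card_fin]
    ring

lemma hasLogMean_gramDet_productChannel [IsProbabilityMeasure P] (hQ : IsRayleigh P N Q)
    (hN0 : 1 ≤ N 0) (hmin : ∀ k, N 0 ≤ N k) :
    HasLogMean P (fun ω => gramDet (productChannel N fun k => Q k ω))
      (N 0 * (gConst N - K * Real.eulerMascheroniConstant)) := by
  rw [← sum_digamma_eq_gConst hN0 hmin]
  simpa only [productChannel, Fin.castSucc_lt_last, Finset.filter_true] using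
    hQ.hasLogMean_gramDet_partialProduct hmin (Fin.last K)

lemma lintegral_frobeniusSq_productChannel [IsProbabilityMeasure P] (hQ : IsRayleigh P N Q) :
    ∫⁻ ω, ENNReal.ofReal (frobeniusSq (productChannel N fun k => Q k ω)) ∂P =
      ENNReal.ofReal (N 0 * ∏ k : Fin K, (N k.succ : ℝ)) := by
  rw [ENNReal.ofReal_mul (by positivity), ENNReal.ofReal_prod_of_nonneg fun _ _ => by positivity]
  simpa only [productChannel, Fin.castSucc_lt_last, Finset.filter_true,
    ENNReal.ofReal_natCast] using
    hQ.lintegral_frobeniusSq_partialProduct (Fin.last K)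

lemma integrable_frobeniusSq_productChannel [IsProbabilityMeasure P] (hQ : IsRayleigh P N Q) :
    Integrable (fun ω => frobeniusSq (productChannel N fun k => Q k ω)) P := by
  refine ⟨(measurable_frobeniusSq.comp_aemeasurable
    (hQ.aemeasurable_partialProduct (Fin.last K))).aestronglyMeasurable, ?_⟩
  rw [hasFiniteIntegral_iff_ofReal (.of_forall fun ω => frobeniusSq_nonneg _),
    hQ.lintegral_frobeniusSq_productChannel]
  exact ENNReal.ofReal_lt_top

lemma integral_frobeniusSq_productChannel [IsProbabilityMeasure P] (hQ : IsRayleigh P N Q) :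
    ∫ ω, frobeniusSq (productChannel N fun k => Q k ω) ∂P =
      N 0 * ∏ k : Fin K, (N k.succ : ℝ) := by
  rw [integral_eq_lintegral_of_nonneg_ae (.of_forall fun ω => frobeniusSq_nonneg _)
    hQ.integrable_frobeniusSq_productChannel.aestronglyMeasurable,
    hQ.lintegral_frobeniusSq_productChannel, ENNReal.toReal_ofReal (by positivity)]

end IsRayleigh

end Channel

end RayleighProduct

end

theorem mainTheorem2 {Ω : Type*} [MeasurableSpace Ω] (P : MeasureTheory.Measure Ω)
    [MeasureTheory.IsProbabilityMeasure P] {K : ℕ} (N : Fin (K + 1) → ℕ)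
    (hN0 : 1 ≤ N 0) (hmin : ∀ k, N 0 ≤ N k)
    (Q : (k : Fin K) → Ω → Matrix (Fin (N k.succ)) (Fin (N k.castSucc)) ℂ)
    (hQ : RayleighProduct.IsRayleigh P N Q) (q : ℝ) (hq : 0 ≤ q) :
    MeasureTheory.Integrable
      (fun ω => RayleighProduct.capacity q (RayleighProduct.productChannel N fun k => Q k ω)) P ∧
    (N 0 : ℝ) * Real.log
        (1 + q * Real.exp (RayleighProduct.gConst N - K * Real.eulerMascheroniConstant))
      ≤ RayleighProduct.ergodicCapacity P N Q q ∧
    RayleighProduct.ergodicCapacity P N Q q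
      ≤ (N 0 : ℝ) * Real.log (1 + q * ∏ k : Fin K, (N k.succ : ℝ)) ∧
    RayleighProduct.gConst N = K * Real.eulerMascheroniConstant +
      (1 / (N 0 : ℝ)) * ∑ k : Fin K, ∑ l ∈ Finset.Icc 1 (N 0),
        RayleighProduct.digamma ((N k.succ : ℝ) - l + 1) := by
  have hmeas := hQ.aemeasurable_partialProduct (Fin.last K)
  have hfrob := hQ.integrable_frobeniusSq_productChannel
  have hint := RayleighProduct.integrable_capacity hmeas hfrob hq
  refine ⟨hint, ?lower, ?upper, RayleighProduct.gConst_eq_digamma hN0 hmin⟩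
  case lower =>
    exact RayleighProduct.le_integral_capacity hint
      (hQ.hasLogMean_gramDet_productChannel hN0 hmin) hq
  case upper =>
    exact RayleighProduct.integral_capacity_le hmeas hfrob (by positivity)
      hQ.integral_frobeniusSq_productChannel hq
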